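/- Let $\varphi$ be a monotone DNF formula over variables $x_1,\dots,x_n$, i.e. a finite (possibly empty) disjunction of (possibly empty) conjunctions of unnegated variables, and let $f:\{0,1\}^n\to\{0,1\}$ be the function it defines. Let $0<p_i<1$ and $c_i\ge 0$ for $i=1,\dots,n$. The bits of the input $x$ are independent with $\Pr[x_i=1]=p_i$, and testing $x_i$ costs $c_i$. A testing strategy for $f$ is a Boolean decision tree that computes $f$ and performs no test twice on a root-to-leaf path; it is optimal if its expected cost (the expected sum of the costs of the tests performed on the random input) is minimum among all testing strategies for $f$. Two variables are siblings if they occur in exactly the same set of terms of $\varphi$. The ratio of $x_i$ is $R(i)=q_i/c_i\in(0,\infty]$, where $q_i=1-p_i$ and $R(i)=\infty$ if $c_i=0$. An R-class is an equivalence class of the relation "siblings with equal ratio". Then there exists an optimal testing strategy $S$ for $f$ such that (a) for any siblings $x_i,x_j$ with $R(j)>R(i)$, $x_i$ is not tested before $x_j$ on any root-to-leaf path of $S$; that is, whenever $x_i$ is tested on such a path, $x_j$ has already been tested on it; (b) for every R-class $W$, $S$ is contiguous with respect to $W$: on every root-to-leaf path of $S$, the tests of variables in $W$ that occur on the path are consecutive.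 -/

import Mathlib

namespace DNFEval

/-- A monotone term: the conjunction of the variables in a finite set.  The empty term is
satisfied by every assignment. -/
abbrev MonotoneTerm (n : ℕ) := Finset (Fin n)

/-- A monotone DNF formula over `x_0, …, x_{n-1}`, given by its finite set of terms.
The constant `0` is the formula without terms and the constant `1` is the formula whose only
term is the empty one. -/
abbrev MonotoneDNF (n : ℕ) := Finset (MonotoneTerm n)

/-- The Boolean function defined by a monotone DNF formula. -/
def MonotoneDNF.eval {n : ℕ} (φ : MonotoneDNF n) (x : Fin n → Bool) : Bool :=
  decide (∃ t ∈ φ, ∀ i ∈ t, x i = true)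

/-- Siblings: variables that appear in exactly the same set of terms. -/
def MonotoneDNF.Siblings {n : ℕ} (φ : MonotoneDNF n) (i j : Fin n) : Prop :=
  ∀ t ∈ φ, i ∈ t ↔ j ∈ t

/-- The ratio `q_i / c_i` with `q_i = 1 - p_i`, as an extended nonnegative number:
a free test (`c_i = 0`) has ratio `∞`, since `q_i > 0`. -/
noncomputable def ratio {n : ℕ} (p c : Fin n → ℝ) (i : Fin n) : ENNReal :=
  ENNReal.ofReal (1 - p i) / ENNReal.ofReal (c i)

/-- The R-class of `i`: all siblings of `i` that have the same ratio as `i`. -/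
def rClass {n : ℕ} (φ : MonotoneDNF n) (p c : Fin n → ℝ) (i : Fin n) : Set (Fin n) :=
  {j | φ.Siblings i j ∧ ratio p c i = ratio p c j}

/-- Boolean decision trees.  A node `test i t₀ t₁` tests `x_i`, and continues with `t₀` if
`x_i = 0` and with `t₁` if `x_i = 1`; a leaf outputs a value. -/
inductive DecisionTree (n : ℕ) : Type where
  | leaf (b : Bool) : DecisionTree n
  | test (i : Fin n) (t₀ t₁ : DecisionTree n) : DecisionTree n

/-- The output of a decision tree on the input `x`. -/
def DecisionTree.eval {n : ℕ} : DecisionTree n → (Fin n → Bool) → Bool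
  | .leaf b, _ => b
  | .test i t₀ t₁, x => if x i = true then t₁.eval x else t₀.eval x

/-- The total cost of the tests that a decision tree performs on the input `x`. -/
def DecisionTree.cost {n : ℕ} (c : Fin n → ℝ) : DecisionTree n → (Fin n → Bool) → ℝ
  | .leaf _, _ => 0
  | .test i t₀ t₁, x => c i + (if x i = true then t₁.cost c x else t₀.cost c x)

/-- The sequences of tests along the root-to-leaf paths of a decision tree. -/
def DecisionTree.paths {n : ℕ} : DecisionTree n → Set (List (Fin n))
  | .leaf _ => {[]}
  | .test i t₀ t₁ => List.cons i '' (t₀.paths ∪ t₁.paths)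

/-- The probability of `x` under the product distribution in which bit `i` is `1` with
probability `p i`. -/
def prob {n : ℕ} (p : Fin n → ℝ) (x : Fin n → Bool) : ℝ :=
  ∏ i, if x i = true then p i else 1 - p i

/-- The expected cost of a decision tree on a random input from the product distribution. -/
def DecisionTree.expectedCost {n : ℕ} (p c : Fin n → ℝ) (T : DecisionTree n) : ℝ :=
  ∑ x : Fin n → Bool, prob p x * T.cost c x

/-- A testing strategy for `f`: a decision tree that computes `f` and performs no test twice
on a root-to-leaf path. -/
def IsTestingStrategy {n : ℕ} (f : (Fin n → Bool) → Bool) (T : DecisionTree n) : Prop :=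
  (∀ x, T.eval x = f x) ∧ ∀ π ∈ T.paths, π.Nodup

/-- An optimal testing strategy: one of minimum expected cost. -/
def IsOptimalStrategy {n : ℕ} (p c : Fin n → ℝ) (f : (Fin n → Bool) → Bool)
    (T : DecisionTree n) : Prop :=
  IsTestingStrategy f T ∧
    ∀ T' : DecisionTree n, IsTestingStrategy f T' → T.expectedCost p c ≤ T'.expectedCost p c

/-- No root-to-leaf path performs the test `i` before (that is, without having already
performed) the test `j`. -/
def DecisionTree.NotBefore {n : ℕ} (T : DecisionTree n) (i j : Fin n) : Prop :=
  ∀ l r : List (Fin n), l ++ i :: r ∈ T.paths → j ∈ l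

/-- On every root-to-leaf path, the tests from `W` on that path form one block of consecutive
tests. -/
def DecisionTree.Contiguous {n : ℕ} (T : DecisionTree n) (W : Set (Fin n)) : Prop :=
  ∀ π ∈ T.paths, ∃ l m r : List (Fin n), π = l ++ m ++ r ∧
    (∀ i ∈ l, i ∉ W) ∧ (∀ i ∈ m, i ∈ W) ∧ (∀ i ∈ r, i ∉ W)

end DNFEval

/-! A zero in either of two siblings kills the same terms, so `x = 0` and `y = 0` leave the same
function, and once `x = 0` the value of `y` is irrelevant. This property, `Twins`, is all that is
used of the formula, and it survives fixing other variables.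

Take an optimal tree with root `x` and an untested sibling `y`. Three rearrangements compete with
it: testing `y` at once after `x = 1`, delaying `x` until `y` is due, and interchanging the two
tests. Let `r` be the probability that `y` is tested given `x = 1`, and `d` the extra cost of acting
as if `x = 1`, `y = 0` when in fact `x = 0`, not counting tests of `y`. The first two comparisons
give `(1-r) q_y c_x ≤ q_x q_y d ≤ (1-r) q_x c_y` (`Minimal.exchange`).

If `R(y) > R(x)`, this forces `r = 1` and `d = 0`, and then the interchange is a strict improvement.
Hence (a) holds in every optimal tree (`Minimal.ratio_root`, `Minimal.mem_of_ratio_lt`). If the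
ratios agree, the chain consists of equalities, so moving `y` directly below `x = 1` costs nothing
(`Minimal.advance`). Doing this recursively, and dropping the class of `x` below `x = 0`, turns any
optimal tree into one satisfying (b). -/

namespace DNFEval

open Function

variable {n : ℕ}

/-! ### Read-once trees and grafting -/

namespace DecisionTree

/-- The expected cost, computed recursively under the assumption that no test is repeated. -/
def meanCost (p c : Fin n → ℝ) : DecisionTree n → ℝ
  | .leaf _ => 0
  | .test i t₀ t₁ => c i + (1 - p i) * t₀.meanCost p c + p i * t₁.meanCost p c

/-- All tests of the tree lie in `A`, and no path repeats a test. -/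
def ReadOnce : Finset (Fin n) → DecisionTree n → Prop
  | _, .leaf _ => True
  | A, .test i t₀ t₁ => i ∈ A ∧ ReadOnce (A.erase i) t₀ ∧ ReadOnce (A.erase i) t₁

/-- Replace the topmost nodes `test y t₀ t₁` by `F t₀ t₁`. -/
def graft (y : Fin n) (F : DecisionTree n → DecisionTree n → DecisionTree n) :
    DecisionTree n → DecisionTree n
  | .leaf b => .leaf b
  | .test i t₀ t₁ => if i = y then F t₀ t₁ else .test i (t₀.graft y F) (t₁.graft y F)

/-- The probability that a read-once tree performs the test `y`. -/
def reach (p : Fin n → ℝ) (y : Fin n) : DecisionTree n → ℝ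
  | .leaf _ => 0
  | .test i t₀ t₁ => if i = y then 1 else (1 - p i) * t₀.reach p y + p i * t₁.reach p y

/-- The variable tested at the root, if there is one. -/
def root : DecisionTree n → Option (Fin n)
  | .leaf _ => none
  | .test i _ _ => some i

theorem ReadOnce.mono {T : DecisionTree n} {A B : Finset (Fin n)} (h : A ⊆ B)
    (hT : T.ReadOnce A) : T.ReadOnce B := by
  induction T generalizing A B with
  | leaf => trivial
  | test i t₀ t₁ h₀ h₁ =>
    obtain ⟨hi, r₀, r₁⟩ := hT
    exact ⟨h hi, h₀ (Finset.erase_subset_erase i h) r₀, h₁ (Finset.erase_subset_erase i h) r₁⟩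

theorem ReadOnce.eval_update {T : DecisionTree n} {A : Finset (Fin n)} (hT : T.ReadOnce A)
    {i : Fin n} (hi : i ∉ A) (b : Bool) (x : Fin n → Bool) :
    T.eval (update x i b) = T.eval x := by
  induction T generalizing A with
  | leaf => rfl
  | test k t₀ t₁ h₀ h₁ =>
    obtain ⟨hk, r₀, r₁⟩ := hT
    have hne : k ≠ i := fun h => hi (h ▸ hk)
    have hi' : i ∉ A.erase k := fun h => hi (Finset.mem_of_mem_erase h)
    simp [eval, update_of_ne hne, h₀ r₀ hi', h₁ r₁ hi']

theorem ReadOnce.cost_update {T : DecisionTree n} {A : Finset (Fin n)} (hT : T.ReadOnce A)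
    (c : Fin n → ℝ) {i : Fin n} (hi : i ∉ A) (b : Bool) (x : Fin n → Bool) :
    T.cost c (update x i b) = T.cost c x := by
  induction T generalizing A with
  | leaf => rfl
  | test k t₀ t₁ h₀ h₁ =>
    obtain ⟨hk, r₀, r₁⟩ := hT
    have hne : k ≠ i := fun h => hi (h ▸ hk)
    have hi' : i ∉ A.erase k := fun h => hi (Finset.mem_of_mem_erase h)
    simp [cost, update_of_ne hne, h₀ r₀ hi', h₁ r₁ hi']

theorem paths_nonempty (T : DecisionTree n) : T.paths.Nonempty := by
  induction T with
  | leaf => exact ⟨[], rfl⟩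
  | test i t₀ t₁ h₀ h₁ => exact (h₀.inl).image _

theorem mem_paths_test {i : Fin n} {t₀ t₁ : DecisionTree n} {π : List (Fin n)} :
    π ∈ (test i t₀ t₁).paths ↔ ∃ ρ, (ρ ∈ t₀.paths ∨ ρ ∈ t₁.paths) ∧ i :: ρ = π := Iff.rfl

theorem readOnce_iff_paths {T : DecisionTree n} {A : Finset (Fin n)} :
    T.ReadOnce A ↔ ∀ π ∈ T.paths, π.Nodup ∧ ∀ i ∈ π, i ∈ A := by
  induction T generalizing A with
  | leaf => simp [ReadOnce, paths]
  | test k t₀ t₁ h₀ h₁ =>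
    simp only [ReadOnce, h₀, h₁, mem_paths_test]
    constructor
    · rintro ⟨hk, r₀, r₁⟩ π ⟨ρ, hρ, rfl⟩
      have h : ρ.Nodup ∧ ∀ i ∈ ρ, i ∈ A.erase k := hρ.elim (r₀ ρ) (r₁ ρ)
      refine ⟨List.nodup_cons.2 ⟨fun hm => by simpa using h.2 k hm, h.1⟩, fun i hi => ?_⟩
      rcases List.mem_cons.1 hi with rfl | hi
      · exact hk
      · exact Finset.mem_of_mem_erase (h.2 i hi)
    · intro h
      have key : ∀ ρ, (ρ ∈ t₀.paths ∨ ρ ∈ t₁.paths) → ρ.Nodup ∧ ∀ i ∈ ρ, i ∈ A.erase k := by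
        intro ρ hρ
        obtain ⟨hn, hA⟩ := h _ ⟨ρ, hρ, rfl⟩
        obtain ⟨hk, hn⟩ := List.nodup_cons.1 hn
        exact ⟨hn, fun i hi => Finset.mem_erase.2
          ⟨fun e => hk (e ▸ hi), hA i (List.mem_cons_of_mem _ hi)⟩⟩
      obtain ⟨ρ, hρ⟩ := t₀.paths_nonempty
      exact ⟨(h _ ⟨ρ, .inl hρ, rfl⟩).2 k List.mem_cons_self,
        fun ρ hρ => key ρ (.inl hρ), fun ρ hρ => key ρ (.inr hρ)⟩

theorem meanCost_nonneg {p c : Fin n → ℝ} (hp : ∀ i, 0 < p i ∧ p i < 1) (hc : ∀ i, 0 ≤ c i)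
    (T : DecisionTree n) : 0 ≤ T.meanCost p c := by
  induction T with
  | leaf => exact le_rfl
  | test i t₀ t₁ h₀ h₁ =>
    have := hp i
    have := hc i
    have := mul_nonneg (sub_nonneg.2 (hp i).2.le) h₀
    have := mul_nonneg (hp i).1.le h₁
    simp only [meanCost]
    linarith

theorem reach_le_one {p : Fin n → ℝ} (hp : ∀ i, 0 < p i ∧ p i < 1) (y : Fin n)
    (T : DecisionTree n) : T.reach p y ≤ 1 := by
  induction T with
  | leaf => exact zero_le_one
  | test i t₀ t₁ h₀ h₁ =>
    simp only [reach]
    split_ifs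
    · exact le_rfl
    · have := mul_le_mul_of_nonneg_left h₀ (sub_nonneg.2 (hp i).2.le)
      have := mul_le_mul_of_nonneg_left h₁ (hp i).1.le
      linarith

theorem graft_test (y : Fin n) (T : DecisionTree n) : T.graft y (test y) = T := by
  induction T with
  | leaf => rfl
  | test i t₀ t₁ h₀ h₁ =>
    simp only [graft]
    split_ifs with h
    · rw [h]
    · rw [h₀, h₁]

/-- This puts all rearrangements on a common scale: each cost is expressed by `reach` and by the
costs of the two trees with `y` contracted to a constant. The weights must sum to `1` because tests
other than `y` are charged in both contractions. -/
theorem meanCost_graft {p c : Fin n → ℝ} {y : Fin n}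
    {F : DecisionTree n → DecisionTree n → DecisionTree n} {a α β : ℝ} (hαβ : α + β = 1)
    (hF : ∀ t₀ t₁, (F t₀ t₁).meanCost p c = a + α * t₀.meanCost p c + β * t₁.meanCost p c)
    (T : DecisionTree n) :
    (T.graft y F).meanCost p c = a * T.reach p y
      + α * (T.graft y fun t₀ _ => t₀).meanCost p c
      + β * (T.graft y fun _ t₁ => t₁).meanCost p c := by
  induction T with
  | leaf => simp [graft, reach, meanCost]
  | test i t₀ t₁ h₀ h₁ =>
    simp only [graft, reach]
    split_ifs with h
    · rw [hF, mul_one]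
    · obtain rfl : β = 1 - α := by linarith
      simp only [meanCost, h₀, h₁]
      ring

/-- Here `v` is the bit that `F` consults in place of `y`; below a test of `y` the tree never looks
at `y` again. -/
theorem eval_graft {y : Fin n} {F : DecisionTree n → DecisionTree n → DecisionTree n}
    {v : (Fin n → Bool) → Bool}
    (hF : ∀ t₀ t₁ z, (F t₀ t₁).eval z = if v z = true then t₁.eval z else t₀.eval z)
    {T : DecisionTree n} {A : Finset (Fin n)} (hT : T.ReadOnce A) (z : Fin n → Bool) :
    (T.graft y F).eval z = T.eval (update z y (v z)) := by
  induction T generalizing A with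
  | leaf => rfl
  | test i t₀ t₁ h₀ h₁ =>
    obtain ⟨hi, r₀, r₁⟩ := hT
    simp only [graft]
    split_ifs with h
    · subst h
      rw [hF, eval, update_self, r₀.eval_update (by simp), r₁.eval_update (by simp)]
    · simp only [eval, h₀ r₀, h₁ r₁, update_of_ne h]

/-- The set `C` holds the variables that `F` itself may test. -/
theorem ReadOnce.graft {y : Fin n} {F : DecisionTree n → DecisionTree n → DecisionTree n}
    {C : Finset (Fin n)}
    (hF : ∀ (B : Finset (Fin n)) t₀ t₁, Disjoint (B.erase y) C → t₀.ReadOnce (B.erase y) →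
      t₁.ReadOnce (B.erase y) → (F t₀ t₁).ReadOnce (B.erase y ∪ C))
    {T : DecisionTree n} {B : Finset (Fin n)} (hC : Disjoint (B.erase y) C)
    (hT : T.ReadOnce B) : (T.graft y F).ReadOnce (B.erase y ∪ C) := by
  induction T generalizing B with
  | leaf => trivial
  | test i t₀ t₁ h₀ h₁ =>
    obtain ⟨hi, r₀, r₁⟩ := hT
    simp only [DecisionTree.graft]
    split_ifs with h
    · subst h
      exact hF B t₀ t₁ hC r₀ r₁
    · have hiB : i ∈ B.erase y := Finset.mem_erase.2 ⟨h, hi⟩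
      have hiC : i ∉ C := Finset.disjoint_left.1 hC hiB
      have hE : (B.erase i).erase y ∪ C = (B.erase y ∪ C).erase i := by
        rw [Finset.erase_union_distrib, Finset.erase_eq_of_notMem hiC, Finset.erase_right_comm]
      have hC' : Disjoint ((B.erase i).erase y) C :=
        hC.mono_left (Finset.erase_subset_erase y (Finset.erase_subset i B))
      exact ⟨Finset.mem_union_left _ hiB, hE ▸ h₀ hC' r₀, hE ▸ h₁ hC' r₁⟩

end DecisionTree

/-! ### Restrictions and optimal trees -/

open DecisionTree

/-- Fixing the value of one variable. -/
def fix (f : (Fin n → Bool) → Bool) (i : Fin n) (b : Bool) (x : Fin n → Bool) : Bool :=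
  f (update x i b)

/-- `T` computes `f`, testing only variables in `A`, and none twice on a path. -/
def Computes (A : Finset (Fin n)) (f : (Fin n → Bool) → Bool) (T : DecisionTree n) : Prop :=
  T.ReadOnce A ∧ ∀ x, T.eval x = f x

/-- `T` has minimum expected cost among the read-once trees over `A` that compute `f`. -/
def Minimal (p c : Fin n → ℝ) (A : Finset (Fin n)) (f : (Fin n → Bool) → Bool)
    (T : DecisionTree n) : Prop :=
  Computes A f T ∧ ∀ T', Computes A f T' → T.meanCost p c ≤ T'.meanCost p c

/-- Setting `x_i` to `0` has the same effect as setting `x_j` to `0`. -/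
def Twins (f : (Fin n → Bool) → Bool) (i j : Fin n) : Prop :=
  ∀ x, f (update x i false) = f (update x j false)

theorem computes_test {A : Finset (Fin n)} {f : (Fin n → Bool) → Bool} {i : Fin n}
    {t₀ t₁ : DecisionTree n} :
    Computes A f (.test i t₀ t₁) ↔ i ∈ A ∧ Computes (A.erase i) (fix f i false) t₀ ∧
      Computes (A.erase i) (fix f i true) t₁ := by
  constructor
  · rintro ⟨⟨hi, r₀, r₁⟩, h⟩
    refine ⟨hi, ⟨r₀, fun x => ?_⟩, r₁, fun x => ?_⟩
    · rw [fix, ← h, DecisionTree.eval, update_self, r₀.eval_update (by simp)]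
      simp
    · rw [fix, ← h, DecisionTree.eval, update_self, r₁.eval_update (by simp)]
      simp
  · rintro ⟨hi, ⟨r₀, h₀⟩, r₁, h₁⟩
    refine ⟨⟨hi, r₀, r₁⟩, fun x => ?_⟩
    rw [DecisionTree.eval, h₀, h₁, fix, fix]
    split_ifs with h
    · rw [← h, update_eq_self]
    · rw [← Bool.eq_false_iff.2 h, update_eq_self]

theorem Computes.mono {A B : Finset (Fin n)} {f : (Fin n → Bool) → Bool} {T : DecisionTree n}
    (h : A ⊆ B) (hT : Computes A f T) : Computes B f T := ⟨hT.1.mono h, hT.2⟩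

section cost

variable {p c : Fin n → ℝ}

theorem Minimal.subtrees (hp : ∀ i, 0 < p i ∧ p i < 1) {A : Finset (Fin n)}
    {f : (Fin n → Bool) → Bool} {i : Fin n} {t₀ t₁ : DecisionTree n}
    (h : Minimal p c A f (.test i t₀ t₁)) :
    Minimal p c (A.erase i) (fix f i false) t₀ ∧ Minimal p c (A.erase i) (fix f i true) t₁ := by
  obtain ⟨hi, h₀, h₁⟩ := computes_test.1 h.1
  refine ⟨⟨h₀, fun T hT => ?_⟩, h₁, fun T hT => ?_⟩
  · have := h.2 _ (computes_test.2 ⟨hi, hT, h₁⟩)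
    simp only [meanCost] at this
    exact le_of_mul_le_mul_left (by linarith) (sub_pos.2 (hp i).2)
  · have := h.2 _ (computes_test.2 ⟨hi, h₀, hT⟩)
    simp only [meanCost] at this
    exact le_of_mul_le_mul_left (by linarith) (hp i).1

theorem Minimal.congr {A : Finset (Fin n)} {f : (Fin n → Bool) → Bool} {T T' : DecisionTree n}
    (h : Minimal p c A f T) (hT : Computes A f T') (hle : T'.meanCost p c ≤ T.meanCost p c) :
    Minimal p c A f T' :=
  ⟨hT, fun T'' h'' => hle.trans (h.2 T'' h'')⟩

/-- Replacing the subtrees of an optimal tree by trees that cost no more. -/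
theorem Minimal.replace (hp : ∀ i, 0 < p i ∧ p i < 1) {A : Finset (Fin n)}
    {f : (Fin n → Bool) → Bool} {i : Fin n} {t₀ t₁ u₀ u₁ : DecisionTree n}
    (h : Minimal p c A f (.test i t₀ t₁))
    (h₀ : Computes (A.erase i) (fix f i false) u₀) (h₁ : Computes (A.erase i) (fix f i true) u₁)
    (l₀ : u₀.meanCost p c ≤ t₀.meanCost p c) (l₁ : u₁.meanCost p c ≤ t₁.meanCost p c) :
    Minimal p c A f (.test i u₀ u₁) := by
  refine h.congr (computes_test.2 ⟨(computes_test.1 h.1).1, h₀, h₁⟩) ?_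
  have := mul_le_mul_of_nonneg_left l₀ (sub_nonneg.2 (hp i).2.le)
  have := mul_le_mul_of_nonneg_left l₁ (hp i).1.le
  simp only [meanCost]
  linarith

/-- Dynamic programming: for nonconstant `f`, take the best root among the finitely many in `A`,
with optimal subtrees supplied by induction. -/
theorem exists_minimal (hp : ∀ i, 0 < p i ∧ p i < 1) (hc : ∀ i, 0 ≤ c i) (A : Finset (Fin n))
    (f : (Fin n → Bool) → Bool) (hf : DependsOn f (A : Set (Fin n))) :
    ∃ T, Minimal p c A f T := by
  induction A using Finset.strongInduction generalizing f with
  | H A ih =>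
    by_cases hconst : ∃ b, ∀ x, f x = b
    · obtain ⟨b, hb⟩ := hconst
      exact ⟨.leaf b, ⟨trivial, fun x => (hb x).symm⟩, fun T _ => meanCost_nonneg hp hc T⟩
    have hfix : ∀ i b, DependsOn (fix f i b) ((A.erase i : Finset (Fin n)) : Set (Fin n)) := by
      intro i b x y hxy
      refine hf fun j hj => ?_
      by_cases hji : j = i
      · subst hji; simp
      · rw [update_of_ne hji, update_of_ne hji]
        exact hxy j (by simpa [hji] using hj)
    have hsub : ∀ i b, ∃ T, i ∈ A → Minimal p c (A.erase i) (fix f i b) T := by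
      intro i b
      by_cases hi : i ∈ A
      · obtain ⟨T, hT⟩ := ih _ (Finset.erase_ssubset hi) _ (hfix i b)
        exact ⟨T, fun _ => hT⟩
      · exact ⟨.leaf true, fun h => absurd h hi⟩
    choose best hbest using hsub
    have hA : A.Nonempty := by
      rw [Finset.nonempty_iff_ne_empty]
      rintro rfl
      exact hconst ⟨f fun _ => true, fun x => hf (by simp)⟩
    obtain ⟨i, hi, hmin⟩ := A.exists_min_image
      (fun i => (DecisionTree.test i (best i false) (best i true)).meanCost p c) hA
    refine ⟨_, computes_test.2 ⟨hi, (hbest i false hi).1, (hbest i true hi).1⟩, fun T hT => ?_⟩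
    cases T with
    | leaf b => exact absurd ⟨b, fun x => (hT.2 x).symm⟩ hconst
    | test j t₀ t₁ =>
      obtain ⟨hj, h₀, h₁⟩ := computes_test.1 hT
      refine (hmin j hj).trans ?_
      have := mul_le_mul_of_nonneg_left ((hbest j false hj).2 _ h₀) (sub_nonneg.2 (hp j).2.le)
      have := mul_le_mul_of_nonneg_left ((hbest j true hj).2 _ h₁) (hp j).1.le
      simp only [meanCost]
      linarith

/-- Tests of irrelevant variables can be removed from a tree at no cost. -/
theorem Computes.exists_relevant (hp : ∀ i, 0 < p i ∧ p i < 1) (hc : ∀ i, 0 ≤ c i)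
    {A B : Finset (Fin n)} {f : (Fin n → Bool) → Bool} {T : DecisionTree n}
    (hf : ∀ i ∉ B, ∀ x b, f (update x i b) = f x) (hT : Computes A f T) :
    ∃ T', Computes B f T' ∧ T'.meanCost p c ≤ T.meanCost p c := by
  induction T generalizing A B f with
  | leaf b => exact ⟨.leaf b, ⟨trivial, hT.2⟩, le_rfl⟩
  | test i t₀ t₁ ih₀ ih₁ =>
    obtain ⟨hi, h₀, h₁⟩ := computes_test.1 hT
    have hq := sub_nonneg.2 (hp i).2.le
    by_cases hiB : i ∈ B
    · have hfix : ∀ b, ∀ j ∉ B.erase i, ∀ x d, fix f i b (update x j d) = fix f i b x := by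
        intro b j hj x d
        by_cases hji : j = i
        · subst hji; simp [fix]
        · rw [fix, update_comm hji, hf j (by simpa [hji] using hj), fix]
      obtain ⟨u₀, hu₀, l₀⟩ := ih₀ (hfix false) h₀
      obtain ⟨u₁, hu₁, l₁⟩ := ih₁ (hfix true) h₁
      refine ⟨.test i u₀ u₁, computes_test.2 ⟨hiB, hu₀, hu₁⟩, ?_⟩
      have := mul_le_mul_of_nonneg_left l₀ hq
      have := mul_le_mul_of_nonneg_left l₁ (hp i).1.le
      simp only [meanCost]
      linarith
    · have hfix : ∀ b, fix f i b = f := fun b => funext fun x => hf i hiB x b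
      rw [hfix] at h₀ h₁
      obtain ⟨u₀, hu₀, l₀⟩ := ih₀ hf h₀
      obtain ⟨u₁, hu₁, l₁⟩ := ih₁ hf h₁
      have := hc i
      have := mul_le_mul_of_nonneg_left l₀ hq
      have := mul_le_mul_of_nonneg_left l₁ (hp i).1.le
      -- Both subtrees compute `f`, and the cheaper one costs at most their weighted mean.
      rcases le_total (u₀.meanCost p c) (u₁.meanCost p c) with h | h
      · have := mul_le_mul_of_nonneg_left h (hp i).1.le
        refine ⟨u₀, hu₀, ?_⟩
        simp only [meanCost]
        linarith
      · have := mul_le_mul_of_nonneg_left h hq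
        refine ⟨u₁, hu₁, ?_⟩
        simp only [meanCost]
        linarith

end cost

/-! ### Twin variables -/

namespace Twins

variable {f : (Fin n → Bool) → Bool} {i j : Fin n}

theorem fix_false (h : Twins f i j) : fix f i false = fix f j false := funext h

theorem apply_update_left (h : Twins f i j) (x : Fin n → Bool) (b : Bool) :
    f (update (update x j b) i false) = f (update x i false) := by
  rw [h, update_idem, h]

theorem eq_of_left_eq_false (h : Twins f i j) (hij : i ≠ j) {x : Fin n → Bool}
    (hx : x i = false) (b : Bool) : f (update x j b) = f x := by
  have h₁ : update (update x j b) i false = update x j b := by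
    rw [update_eq_iff]
    simp [update_of_ne hij, hx]
  have h₂ : update x i false = x := by rw [← hx, update_eq_self]
  rw [← h₁, h.apply_update_left, h₂]

theorem fix (h : Twins f i j) {k : Fin n} (hi : i ≠ k) (hj : j ≠ k) (b : Bool) :
    Twins (fix f k b) i j := by
  intro x
  rw [DNFEval.fix, DNFEval.fix, update_comm hi, update_comm hj, h]

theorem fix_true_fix_false (h : Twins f i j) (hij : i ≠ j) :
    DNFEval.fix (DNFEval.fix f i true) j false = DNFEval.fix f i false := by
  funext x
  rw [DNFEval.fix, DNFEval.fix, DNFEval.fix, update_comm hij.symm, ← h, update_idem]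

end Twins

/-! ### Exchange arguments -/

section exchange

variable {p c : Fin n → ℝ} {A : Finset (Fin n)} {f : (Fin n → Bool) → Bool} {x y : Fin n}
  {s₀ s₁ u₀ : DecisionTree n}

/-- After `x = 1`, the sibling `y` can be tested at once. -/
theorem computes_advance (hxy : Twins f x y) (hne : y ≠ x) (hy : y ∈ A)
    (hS : Computes A f (.test x s₀ s₁))
    (hu : Computes ((A.erase x).erase y) (fix f x false) u₀) :
    Computes A f (.test x s₀ (.test y u₀ (s₁.graft y fun _ t₁ => t₁))) := by
  obtain ⟨hx, h₀, h₁⟩ := computes_test.1 hS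
  refine computes_test.2 ⟨hx, h₀, computes_test.2 ⟨Finset.mem_erase.2 ⟨hne, hy⟩, ?_, ?_, ?_⟩⟩
  · rwa [hxy.fix_true_fix_false hne.symm]
  · have := ReadOnce.graft (y := y) (F := fun _ t₁ => t₁) (C := ∅)
      (fun B t₀ t₁ _ _ r₁ => by simpa using r₁) (by simp) h₁.1
    simpa using this
  · intro z
    rw [eval_graft (v := fun _ => true) (by simp) h₁.1, h₁.2]
    rfl

/-- The test of `x` can be delayed until its sibling `y` is to be tested. -/
theorem computes_delay (hxy : Twins f x y) (hne : y ≠ x) (hy : y ∈ A)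
    (hS : Computes A f (.test x s₀ s₁)) :
    Computes A f (s₁.graft y fun t₀ t₁ => .test x t₀ (.test y t₀ t₁)) := by
  obtain ⟨hx, h₀, h₁⟩ := computes_test.1 hS
  constructor
  · have hd : Disjoint ((A.erase x).erase y) {x, y} := by
      rw [Finset.disjoint_right]
      simp
    have := ReadOnce.graft (y := y) (F := fun t₀ t₁ => .test x t₀ (.test y t₀ t₁)) (C := {x, y})
      (fun B t₀ t₁ hB r₀ r₁ => ?_) hd h₁.1
    · refine this.mono fun i hi => ?_
      simp only [Finset.mem_union, Finset.mem_erase, Finset.mem_insert,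
        Finset.mem_singleton] at hi
      rcases hi with hi | rfl | rfl
      exacts [hi.2.2, hx, hy]
    · have hxB : x ∉ B.erase y := Finset.disjoint_right.1 hB (by simp)
      have hsub : B.erase y ⊆ (B.erase y ∪ {x, y}).erase x := fun i hi =>
        Finset.mem_erase.2 ⟨fun e => hxB (e ▸ hi), Finset.mem_union_left _ hi⟩
      have hsub' : B.erase y ⊆ ((B.erase y ∪ {x, y}).erase x).erase y := fun i hi =>
        Finset.mem_erase.2 ⟨(Finset.mem_erase.1 hi).1, hsub hi⟩
      exact ⟨by simp, r₀.mono hsub, by simp [hne], r₀.mono hsub', r₁.mono hsub'⟩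
  · intro z
    -- The new tree evaluates `f` at `x := 1`, `y := x ∧ y`. This changes nothing if `x = 1`, and if
    -- `x = 0` the zero is merely moved from `x` to its twin.
    rw [eval_graft (v := fun z => z x && z y) (fun t₀ t₁ z => ?_) h₁.1, h₁.2, fix,
      update_comm hne]
    · cases hz : z x with
      | true => rw [← hz, update_eq_self, hz, Bool.true_and, update_eq_self]
      | false =>
        rw [Bool.false_and, ← hxy, update_idem, ← hz, update_eq_self]
    · simp only [DecisionTree.eval]
      cases z x <;> cases z y <;> rfl

/-- The tests of `x` and its sibling `y` can be interchanged. -/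
theorem computes_swap (hxy : Twins f x y) (hne : y ≠ x) (hy : y ∈ A)
    (hS : Computes A f (.test x s₀ s₁))
    (hu : Computes ((A.erase x).erase y) (fix f x false) u₀) :
    Computes A f (.test y u₀ (s₁.graft y (.test x))) := by
  obtain ⟨hx, h₀, h₁⟩ := computes_test.1 hS
  refine computes_test.2 ⟨hy, ?_, ?_, ?_⟩
  · rw [← hxy.fix_false]
    exact hu.mono (Finset.erase_subset_erase y (Finset.erase_subset x A))
  · have := ReadOnce.graft (y := y) (F := .test x) (C := {x})
      (fun B t₀ t₁ hB r₀ r₁ => ?_) (by simp) h₁.1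
    · refine this.mono fun i hi => ?_
      simp only [Finset.mem_union, Finset.mem_erase, Finset.mem_singleton] at hi
      rcases hi with hi | rfl
      · exact Finset.mem_erase.2 ⟨hi.1, hi.2.2⟩
      · exact Finset.mem_erase.2 ⟨hne.symm, hx⟩
    · have hxB : x ∉ B.erase y := Finset.disjoint_right.1 hB (by simp)
      have hsub : B.erase y ⊆ (B.erase y ∪ {x}).erase x := fun i hi =>
        Finset.mem_erase.2 ⟨fun e => hxB (e ▸ hi), Finset.mem_union_left _ hi⟩
      exact ⟨by simp, r₀.mono hsub, r₁.mono hsub⟩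
  · intro z
    -- Once `y = 1` is known, `s₁` may read the bit of `x` in place of `y`, by the twin symmetry.
    rw [eval_graft (v := fun z => z x) (fun t₀ t₁ z => by rw [DecisionTree.eval]) h₁.1, h₁.2,
      fix, fix, update_comm hne]
    cases hz : z x with
    | true => rw [← hz, update_eq_self, hz]
    | false =>
      rw [← hxy, update_idem, ← hz, update_eq_self, hxy.eq_of_left_eq_false hne.symm hz]

theorem exists_computes_erase_sibling (hp : ∀ i, 0 < p i ∧ p i < 1) (hc : ∀ i, 0 ≤ c i)
    (W : Fin n → Prop) [DecidablePred W] (hW : ∀ y ∈ A, W y → Twins f x y)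
    (h₀ : Computes (A.erase x) (fix f x false) s₀) :
    ∃ u₀, Computes ((A.erase x).filter fun y => ¬ W y) (fix f x false) u₀ ∧
      u₀.meanCost p c ≤ s₀.meanCost p c := by
  obtain ⟨v, hv, hle⟩ := h₀.exists_relevant (B := A.erase x) hp hc (fun i hi z b => by
    by_cases hix : i = x
    · simp [fix, hix]
    · rw [← h₀.2, ← h₀.2, h₀.1.eval_update hi])
  obtain ⟨u, hu, hle'⟩ := hv.exists_relevant
    (B := (A.erase x).filter fun y => ¬ W y) hp hc (fun i hi z b => by
    by_cases hiA : i ∈ A.erase x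
    · have hWi : W i := by_contra fun h => hi (Finset.mem_filter.2 ⟨hiA, h⟩)
      exact (hW i (Finset.mem_of_mem_erase hiA) hWi).apply_update_left z b
    · rw [← h₀.2, ← h₀.2, h₀.1.eval_update hiA])
  exact ⟨u, hu, hle'.trans hle⟩

/-- What minimality of a tree with root `x` says when compared with the trees in which the test
of the sibling `y` is advanced, the test of `x` is delayed, or the two tests are interchanged.
Here `r` is the probability of testing `y` given `x = 1`, and `d` is the expected loss from
ignoring that `x = 0`, until `y` is to be tested. -/
theorem Minimal.exchange (hp : ∀ i, 0 < p i ∧ p i < 1)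
    (hxy : Twins f x y) (hne : y ≠ x) (hy : y ∈ A)
    (hS : Minimal p c A f (.test x s₀ s₁))
    (hu : Computes ((A.erase x).erase y) (fix f x false) u₀)
    (hle : u₀.meanCost p c ≤ s₀.meanCost p c) :
    ∃ r d : ℝ, r ≤ 1 ∧
      (1 - p y) * d ≤ (1 - r) * c y ∧
      (1 - r) * c x ≤ (1 - p x) * d ∧
      (1 - r) * (c x - c y) - (p y - p x) * d
        + r * ((1 - p y) * c x - (1 - p x) * c y) ≤ 0 ∧
      (DecisionTree.test x s₀ (.test y u₀ (s₁.graft y fun _ t₁ => t₁))).meanCost p c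
        ≤ (DecisionTree.test x s₀ s₁).meanCost p c + p x * ((1 - r) * c y - (1 - p y) * d) := by
  have hs₁ := meanCost_graft (p := p) (c := c) (y := y) (F := .test y) (a := c y)
    (α := 1 - p y) (β := p y) (by ring) (fun _ _ => rfl) s₁
  have hd := meanCost_graft (p := p) (c := c) (y := y)
    (F := fun t₀ t₁ => .test x t₀ (.test y t₀ t₁)) (a := c x + p x * c y)
    (α := 1 - p x + p x * (1 - p y)) (β := p x * p y) (by ring)
    (fun _ _ => by simp only [meanCost]; ring) s₁
  have hw := meanCost_graft (p := p) (c := c) (y := y) (F := .test x) (a := c x)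
    (α := 1 - p x) (β := p x) (by ring) (fun _ _ => rfl) s₁
  have m₁ := hS.2 _ (computes_advance hxy hne hy hS.1 hu)
  have m₂ := hS.2 _ (computes_delay hxy hne hy hS.1)
  have m₃ := hS.2 _ (computes_swap hxy hne hy hS.1 hu)
  rw [graft_test] at hs₁
  rw [hd] at m₂
  simp only [meanCost, hs₁, hw] at m₁ m₂ m₃ ⊢
  set r := s₁.reach p y
  set k₀ := (s₁.graft y fun t₀ _ => t₀).meanCost p c
  set k₁ := (s₁.graft y fun _ t₁ => t₁).meanCost p c
  set a := s₀.meanCost p c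
  set b := u₀.meanCost p c
  have hpx := (hp x).1
  have hqy := sub_pos.2 (hp y).2
  have hb : (1 - p y) * b ≤ (1 - p y) * a := mul_le_mul_of_nonneg_left hle hqy.le
  have hb' : p x * ((1 - p y) * b) ≤ p x * ((1 - p y) * a) := mul_le_mul_of_nonneg_left hb hpx.le
  -- In all four trees `k₁` has the coefficient `p x * p y`, so it cancels from every comparison.
  refine ⟨r, k₀ - a, reach_le_one hp y s₁, ?_, ?_, ?_, ?_⟩
  · refine le_of_mul_le_mul_left (a := p x) ?_ hpx
    linarith
  · linarith
  · linarith
  · linarith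

/-- In an optimal tree, the test at the root is not of smaller ratio than an available
sibling. -/
theorem Minimal.ratio_root (hp : ∀ i, 0 < p i ∧ p i < 1) (hc : ∀ i, 0 ≤ c i)
    (hxy : Twins f x y) (hne : y ≠ x) (hy : y ∈ A) (hS : Minimal p c A f (.test x s₀ s₁)) :
    (1 - p y) * c x ≤ (1 - p x) * c y := by
  by_contra! hlt
  obtain ⟨u, hu, hle⟩ := exists_computes_erase_sibling hp hc (p := p) (c := c) (· = y)
    (fun z _ hz => hz ▸ hxy) (computes_test.1 hS.1).2.1
  rw [Finset.filter_ne'] at hu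
  obtain ⟨r, d, hr, h₁, h₂, h₃, -⟩ := hS.exchange hp hxy hne hy hu hle
  have hqx := sub_pos.2 (hp x).2
  have hqy := sub_pos.2 (hp y).2
  have h₁' := mul_le_mul_of_nonneg_left h₁ hqx.le
  have h₂' := mul_le_mul_of_nonneg_left h₂ hqy.le
  -- Chaining `h₂'` and `h₁'` gives `(1-r) q_y c_x ≤ (1-r) q_x c_y`, which contradicts `hlt` if `r <
  -- 1`.
  have hr1 : r = 1 := by
    refine le_antisymm hr (not_lt.1 fun h => ?_)
    have := mul_lt_mul_of_pos_left hlt (sub_pos.2 h)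
    linarith
  subst hr1
  have hd0 : d = 0 := by
    refine le_antisymm ?_ ?_
    · exact le_of_mul_le_mul_left (by linarith) hqy
    · exact le_of_mul_le_mul_left (by linarith) hqx
  subst hd0
  linarith

/-- A sibling of the root variable with the same ratio can be tested right after it. -/
theorem Minimal.advance (hp : ∀ i, 0 < p i ∧ p i < 1)
    (hxy : Twins f x y) (hne : y ≠ x) (hy : y ∈ A) (hS : Minimal p c A f (.test x s₀ s₁))
    (hr : (1 - p y) * c x = (1 - p x) * c y)
    (hu : Computes ((A.erase x).erase y) (fix f x false) u₀)
    (hle : u₀.meanCost p c ≤ s₀.meanCost p c) :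
    Minimal p c A f (.test x s₀ (.test y u₀ (s₁.graft y fun _ t₁ => t₁))) := by
  obtain ⟨r, d, -, h₁, h₂, -, h₄⟩ := hS.exchange hp hxy hne hy hu hle
  refine hS.congr (computes_advance hxy hne hy hS.1 hu) (h₄.trans ?_)
  have hqx := sub_pos.2 (hp x).2
  have hqy := sub_pos.2 (hp y).2
  have h₂' := mul_le_mul_of_nonneg_left h₂ hqy.le
  -- By `hr` this is `h₂'`, the reverse of `h₁` up to a positive factor; it makes the correction
  -- term in `h₄` nonpositive.
  have : (1 - p x) * ((1 - r) * c y) ≤ (1 - p x) * ((1 - p y) * d) := by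
    have := congrArg (fun t => (1 - r) * t) hr
    linarith
  have := le_of_mul_le_mul_left this hqx
  have := mul_nonneg (hp x).1.le (sub_nonneg.2 this)
  linarith

end exchange

/-! ### Contiguity and the order of ratios -/

section contiguity

variable {p c : Fin n → ℝ} {A : Finset (Fin n)} {f : (Fin n → Bool) → Bool} {T : DecisionTree n}

/-- A root in `W` can join the block below it only if that block is empty or starts immediately; a
root outside `W` needs no condition. -/
theorem DecisionTree.contiguous_test {W : Set (Fin n)} {x : Fin n} {t₀ t₁ : DecisionTree n}
    (h₀ : t₀.Contiguous W) (h₁ : t₁.Contiguous W)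
    (h : x ∈ W → ∀ π, π ∈ t₀.paths ∨ π ∈ t₁.paths → (∀ i ∈ π, i ∉ W) ∨
      ∃ i ∈ W, ∃ ρ, π = i :: ρ) :
    (DecisionTree.test x t₀ t₁).Contiguous W := by
  intro π hπ
  obtain ⟨ρ, hρ, rfl⟩ := mem_paths_test.1 hπ
  obtain ⟨l, m, r, rfl, hl, hm, hr⟩ : ∃ l m r : List (Fin n), ρ = l ++ m ++ r ∧
    (∀ i ∈ l, i ∉ W) ∧ (∀ i ∈ m, i ∈ W) ∧ (∀ i ∈ r, i ∉ W) := hρ.elim (h₀ ρ) (h₁ ρ)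
  by_cases hx : x ∈ W
  · rcases h hx _ hρ with hW | ⟨i, hi, ρ, hρ⟩
    · exact ⟨[], [x], _, rfl, by simp, by simpa using hx, hW⟩
    · cases l with
      | nil =>
        refine ⟨[], x :: m, r, rfl, by simp, ?_, hr⟩
        rintro j (_ | ⟨_, hj⟩)
        exacts [hx, hm j hj]
      | cons j l =>
        simp only [List.cons_append, List.cons.injEq] at hρ
        exact absurd (hρ.1 ▸ hi) (hl j List.mem_cons_self)
  · refine ⟨x :: l, m, r, rfl, ?_, hm, hr⟩
    rintro j (_ | ⟨_, hj⟩)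
    exacts [hx, hl j hj]

open Classical in
/-- An optimal tree can be made contiguous with respect to all classes of siblings of equal
ratio, without changing its first test. -/
theorem Minimal.exists_contiguous (hp : ∀ i, 0 < p i ∧ p i < 1) (hc : ∀ i, 0 ≤ c i)
    (s : Setoid (Fin n)) (hs : ∀ x y, s x y → (1 - p y) * c x = (1 - p x) * c y)
    (hA : ∀ x ∈ A, ∀ y ∈ A, x ≠ y → s x y → Twins f x y) (hT : Minimal p c A f T) :
    ∃ T', Minimal p c A f T' ∧ T'.root = T.root ∧ ∀ x, T'.Contiguous {y | s x y} := by
  induction A using Finset.strongInduction generalizing f T with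
  | H A ih =>
  cases T with
  | leaf b =>
    refine ⟨_, hT, rfl, fun x π hπ => ⟨[], [], [], ?_, by simp, by simp, by simp⟩⟩
    simpa [paths] using hπ
  | test x s₀ s₁ =>
  obtain ⟨hx, h₀, h₁⟩ := computes_test.1 hT.1
  have hfix : ∀ b, ∀ i ∈ A.erase x, ∀ j ∈ A.erase x, i ≠ j → s i j → Twins (fix f x b) i j := by
    intro b i hi j hj hij hr
    rw [Finset.mem_erase] at hi hj
    exact (hA i hi.2 j hj.2 hij hr).fix hi.1 hj.1 b
  have hsub : A.erase x ⊂ A := Finset.erase_ssubset hx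
  have htw : ∀ y ∈ A, s x y ∧ y ≠ x → Twins f x y := fun y hy h => hA x hx y hy h.2.symm h.1
  -- the branch `x = 0`, where no further test of the class of `x` is needed
  obtain ⟨u₀, hu₀, hle₀, hc₀⟩ : ∃ u₀, Computes ((A.erase x).filter fun y => ¬ s x y)
      (fix f x false) u₀ ∧ u₀.meanCost p c ≤ s₀.meanCost p c ∧
      ∀ z, u₀.Contiguous {y | s z y} := by
    obtain ⟨v, hv, hle⟩ := exists_computes_erase_sibling hp hc (fun y => s x y ∧ y ≠ x) htw h₀
    have hB : (A.erase x).filter (fun y => ¬ (s x y ∧ y ≠ x)) =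
        (A.erase x).filter (fun y => ¬ s x y) := by
      refine Finset.filter_congr fun y hy => ?_
      simp [(Finset.mem_erase.1 hy).1]
    rw [hB] at hv
    have hBsub : (A.erase x).filter (fun y => ¬ s x y) ⊆ A.erase x := Finset.filter_subset _ _
    -- `v` costs no more than `s₀`, which is already optimal over the larger set `A.erase x`.
    have hvmin : Minimal p c ((A.erase x).filter fun y => ¬ s x y) (fix f x false) v :=
      ⟨hv, fun T' hT' => hle.trans ((hT.subtrees hp).1.2 _ (hT'.mono hBsub))⟩
    obtain ⟨u, hu, -, hcu⟩ := ih _ (hBsub.trans_ssubset hsub)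
      (fun i hi j hj => hfix false i (hBsub hi) j (hBsub hj)) hvmin
    exact ⟨u, hu.1, (hu.2 _ hv).trans hle, hcu⟩
  have hu₀' : Computes (A.erase x) (fix f x false) u₀ := hu₀.mono (Finset.filter_subset _ _)
  have hpath₀ : ∀ z, s z x → ∀ π ∈ u₀.paths, ∀ i ∈ π, i ∉ {y | s z y} := by
    intro z hz π hπ i hi hzi
    exact (Finset.mem_filter.1 ((readOnce_iff_paths.1 hu₀.1 π hπ).2 i hi)).2
      (s.trans (s.symm hz) hzi)
  by_cases hex : ∃ y ∈ A, y ≠ x ∧ s x y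
  · obtain ⟨y, hy, hne, hxy⟩ := hex
    have htwin := hA x hx y hy hne.symm hxy
    obtain ⟨v, hv, hle⟩ := exists_computes_erase_sibling hp hc (p := p) (c := c) (· = y)
      (fun z _ hz => hz ▸ htwin) h₀
    rw [Finset.filter_ne'] at hv
    have hadv := hT.advance hp htwin hne hy (hs x y hxy) hv hle
    -- The induction keeps the root `y`, so the block of the class continues directly below `x`.
    obtain ⟨t, ht, hroot, hct⟩ := ih _ hsub (hfix true) (hadv.subtrees hp).2
    refine ⟨.test x u₀ t, hadv.replace hp hu₀' ht.1 hle₀ (ht.2 _ (hadv.subtrees hp).2.1), rfl,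
      fun z => contiguous_test (hc₀ z) (hct z) ?_⟩
    rintro hz π (hπ | hπ)
    · exact .inl (hpath₀ z hz π hπ)
    · refine .inr ⟨y, s.trans hz hxy, ?_⟩
      cases t with
      | leaf b => simp [root] at hroot
      | test k t₀ t₁ =>
        obtain rfl : k = y := by simpa [root] using hroot
        obtain ⟨ρ, -, rfl⟩ := mem_paths_test.1 hπ
        exact ⟨ρ, rfl⟩
  · obtain ⟨t, ht, -, hct⟩ := ih _ hsub (hfix true) (hT.subtrees hp).2
    refine ⟨.test x u₀ t, hT.replace hp hu₀' ht.1 hle₀ (ht.2 _ h₁), rfl,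
      fun z => contiguous_test (hc₀ z) (hct z) ?_⟩
    rintro hz π (hπ | hπ)
    · exact .inl (hpath₀ z hz π hπ)
    · refine .inl fun i hi hzi => hex ?_
      have := Finset.mem_erase.1 ((readOnce_iff_paths.1 ht.1.1 π hπ).2 i hi)
      exact ⟨i, this.2, this.1, s.trans (s.symm hz) hzi⟩

/-- In an optimal tree, no test is performed before a sibling of larger ratio. -/
theorem Minimal.mem_of_ratio_lt (hp : ∀ i, 0 < p i ∧ p i < 1) (hc : ∀ i, 0 ≤ c i)
    (hT : Minimal p c A f T) {x y : Fin n} (hlt : (1 - p x) * c y < (1 - p y) * c x)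
    (hy : y ∈ A) (hxy : x ∈ A → Twins f x y) {l r : List (Fin n)}
    (hπ : l ++ x :: r ∈ T.paths) : y ∈ l := by
  have hne : y ≠ x := by rintro rfl; exact lt_irrefl _ hlt
  induction T generalizing A f l with
  | leaf b => simp [paths] at hπ
  | test k t₀ t₁ ih₀ ih₁ =>
    obtain ⟨ρ, hρ, he⟩ := mem_paths_test.1 hπ
    cases l with
    | nil =>
      obtain ⟨rfl, -⟩ := List.cons.inj he
      exact absurd (hT.ratio_root hp hc (hxy (computes_test.1 hT.1).1) hne hy) hlt.not_ge
    | cons j l =>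
      obtain ⟨rfl, rfl⟩ := List.cons.inj he
      by_cases hyk : y = k
      · exact hyk ▸ List.mem_cons_self
      · have hy' : y ∈ A.erase k := Finset.mem_erase.2 ⟨hyk, hy⟩
        -- Availability of `x` is a premise, so the case `k = x` is vacuous.
        have hfix : ∀ b, x ∈ A.erase k → Twins (fix f k b) x y := fun b hx =>
          (hxy (Finset.mem_of_mem_erase hx)).fix (Finset.mem_erase.1 hx).1 hyk b
        refine List.mem_cons_of_mem _ ?_
        exact hρ.elim (ih₀ (hT.subtrees hp).1 hy' (hfix false))
          (ih₁ (hT.subtrees hp).2 hy' (hfix true))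

end contiguity

/-! ### Expected cost as a recursion -/

section expectation

theorem prob_update_not (p : Fin n → ℝ) (i : Fin n) (x : Fin n → Bool) :
    (if x i = true then 1 - p i else p i) * prob p x
      = (if x i = true then p i else 1 - p i) * prob p (update x i (!x i)) := by
  have h : ∀ z : Fin n → Bool, prob p z = (if z i = true then p i else 1 - p i) *
      ∏ j ∈ Finset.univ.erase i, if z j = true then p j else 1 - p j := fun z =>
    (Finset.mul_prod_erase _ _ (Finset.mem_univ i)).symm
  have h' : ∏ j ∈ Finset.univ.erase i, (if update x i (!x i) j = true then p j else 1 - p j)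
      = ∏ j ∈ Finset.univ.erase i, if x j = true then p j else 1 - p j :=
    Finset.prod_congr rfl fun j hj => by rw [update_of_ne (Finset.ne_of_mem_erase hj)]
  rw [h x, h (update x i _), h', update_self]
  cases x i <;> simp <;> ring

/-- Conditioning on the value of one bit. -/
theorem sum_prob_ite (p : Fin n → ℝ) (i : Fin n) {g₀ g₁ : (Fin n → Bool) → ℝ}
    (h₀ : ∀ x b, g₀ (update x i b) = g₀ x) (h₁ : ∀ x b, g₁ (update x i b) = g₁ x) :
    ∑ x, prob p x * (if x i = true then g₁ x else g₀ x)
      = (1 - p i) * ∑ x, prob p x * g₀ x + p i * ∑ x, prob p x * g₁ x := by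
  have hinv : Involutive fun x : Fin n → Bool => update x i (!x i) := fun x => by simp
  have hsum : ∀ F : (Fin n → Bool) → ℝ, ∑ x, F (update x i (!x i)) = ∑ x, F x := fun F =>
    Equiv.sum_comp hinv.toPerm F
  have key : ∀ g : (Fin n → Bool) → ℝ, (∀ x b, g (update x i b) = g x) →
      ∑ x, prob p x * (if x i = true then g x else 0) = p i * ∑ x, prob p x * g x := by
    intro g hg
    have h := hsum fun x => (1 - p i) * (prob p x * (if x i = true then g x else 0))
    -- Pointwise, the summand is the change under flipping bit `i` of the function summed in `h`, so
    -- the total vanishes.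
    have h2 : ∑ x, (p i * (prob p x * g x)
        - prob p x * (if x i = true then g x else 0)) = 0 := by
      refine Eq.trans ?_ (sub_eq_zero.2 h)
      rw [← Finset.sum_sub_distrib]
      refine Finset.sum_congr rfl fun x _ => ?_
      have := prob_update_not p i x
      simp only [update_self, hg]
      cases hx : x i
      · simp only [hx, Bool.false_eq_true, if_false] at this
        simp only [Bool.false_eq_true, if_false, Bool.not_false, if_true] at this ⊢
        linear_combination g x * this
      · simp only [Bool.not_true, Bool.false_eq_true, if_false, if_true]
        ring
    rw [Finset.sum_sub_distrib, ← Finset.mul_sum] at h2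
    linarith
  rw [← key g₁ h₁]
  have h := key g₀ h₀
  have hsplit : ∑ x, prob p x * (if x i = true then g₁ x else g₀ x)
      = ∑ x, prob p x * g₀ x - ∑ x, prob p x * (if x i = true then g₀ x else 0)
        + ∑ x, prob p x * (if x i = true then g₁ x else 0) := by
    rw [← Finset.sum_sub_distrib, ← Finset.sum_add_distrib]
    refine Finset.sum_congr rfl fun x _ => ?_
    split_ifs <;> ring
  rw [hsplit, h]
  ring

theorem sum_prob (p : Fin n → ℝ) : ∑ x, prob p x = 1 := by
  have := Fintype.prod_sum (fun (i : Fin n) (b : Bool) => if b = true then p i else 1 - p i)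
  simp only [prob, ← this]
  simp

theorem DecisionTree.ReadOnce.expectedCost_eq (p c : Fin n → ℝ) {T : DecisionTree n}
    {A : Finset (Fin n)} (hT : T.ReadOnce A) : T.expectedCost p c = T.meanCost p c := by
  induction T generalizing A with
  | leaf b => simp [expectedCost, cost, meanCost]
  | test i t₀ t₁ h₀ h₁ =>
    obtain ⟨hi, r₀, r₁⟩ := hT
    simp only [expectedCost, cost, meanCost, mul_add, Finset.sum_add_distrib]
    rw [← Finset.sum_mul, sum_prob, sum_prob_ite p i
      (fun x b => r₀.cost_update c (by simp) b x) (fun x b => r₁.cost_update c (by simp) b x),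
      ← h₀ r₀, ← h₁ r₁, expectedCost, expectedCost]
    ring

end expectation

/-! ### Translation to strategies, formulas and ratios -/

theorem isTestingStrategy_iff {f : (Fin n → Bool) → Bool} {T : DecisionTree n} :
    IsTestingStrategy f T ↔ Computes Finset.univ f T := by
  simp [IsTestingStrategy, Computes, readOnce_iff_paths, and_comm]

theorem isOptimalStrategy_iff {p c : Fin n → ℝ} {f : (Fin n → Bool) → Bool}
    {T : DecisionTree n} : IsOptimalStrategy p c f T ↔ Minimal p c Finset.univ f T := by
  simp only [IsOptimalStrategy, Minimal, isTestingStrategy_iff]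
  refine and_congr_right fun hT => forall₂_congr fun T' hT' => ?_
  rw [hT.1.expectedCost_eq, hT'.1.expectedCost_eq]

theorem MonotoneDNF.Siblings.twins {φ : MonotoneDNF n} {i j : Fin n} (h : φ.Siblings i j) :
    Twins φ.eval i j := by
  have key : ∀ {i j : Fin n}, φ.Siblings i j → ∀ x : Fin n → Bool,
      (∃ t ∈ φ, ∀ k ∈ t, update x i false k = true) →
      ∃ t ∈ φ, ∀ k ∈ t, update x j false k = true := by
    rintro i j h x ⟨t, ht, hx⟩
    refine ⟨t, ht, fun k hk => ?_⟩
    have hi : i ∉ t := fun hi => by simpa using hx i hi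
    have hkj : k ≠ j := fun e => hi ((h t ht).2 (e ▸ hk))
    have hki : k ≠ i := fun e => hi (e ▸ hk)
    simpa [update_of_ne hkj, update_of_ne hki] using hx k hk
  intro x
  exact decide_eq_decide.2 ⟨key h x, key (fun t ht => (h t ht).symm) x⟩

section ratio

variable {p c : Fin n → ℝ}

theorem ratio_of_cost_eq_zero (hp : ∀ i, 0 < p i ∧ p i < 1) {x : Fin n} (h : c x = 0) :
    ratio p c x = ⊤ := by
  simp [ratio, h, ENNReal.div_zero, (hp x).2]

theorem ratio_of_cost_pos {x : Fin n} (h : 0 < c x) :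
    ratio p c x = ENNReal.ofReal ((1 - p x) / c x) :=
  (ENNReal.ofReal_div_of_pos h).symm

theorem mul_lt_mul_of_ratio_lt (hp : ∀ i, 0 < p i ∧ p i < 1) (hc : ∀ i, 0 ≤ c i) {x y : Fin n}
    (h : ratio p c x < ratio p c y) : (1 - p x) * c y < (1 - p y) * c x := by
  have hqy := sub_pos.2 (hp y).2
  rcases (hc x).eq_or_lt' with hx | hx
  · rw [ratio_of_cost_eq_zero hp hx] at h
    exact absurd h not_top_lt
  rcases (hc y).eq_or_lt' with hy | hy
  · rw [hy, mul_zero]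
    exact mul_pos hqy hx
  rw [ratio_of_cost_pos hx, ratio_of_cost_pos hy, ENNReal.ofReal_lt_ofReal_iff (by positivity),
    div_lt_div_iff₀ hx hy] at h
  exact h

theorem mul_eq_mul_of_ratio_eq (hp : ∀ i, 0 < p i ∧ p i < 1) (hc : ∀ i, 0 ≤ c i) {x y : Fin n}
    (h : ratio p c x = ratio p c y) : (1 - p y) * c x = (1 - p x) * c y := by
  have hqx := sub_pos.2 (hp x).2
  have hqy := sub_pos.2 (hp y).2
  rcases (hc x).eq_or_lt' with hx | hx <;> rcases (hc y).eq_or_lt' with hy | hy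
  · simp [hx, hy]
  · rw [ratio_of_cost_eq_zero hp hx, ratio_of_cost_pos hy] at h
    exact absurd h.symm ENNReal.ofReal_ne_top
  · rw [ratio_of_cost_eq_zero hp hy, ratio_of_cost_pos hx] at h
    exact absurd h ENNReal.ofReal_ne_top
  · rw [ratio_of_cost_pos hx, ratio_of_cost_pos hy,
      ENNReal.ofReal_eq_ofReal_iff (by positivity) (by positivity),
      div_eq_div_iff hx.ne' hy.ne'] at h
    exact h.symm

end ratio

/-- The relation of being siblings of equal ratio. -/
def rSetoid (φ : MonotoneDNF n) (p c : Fin n → ℝ) : Setoid (Fin n) where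
  r i j := φ.Siblings i j ∧ ratio p c i = ratio p c j
  iseqv :=
    { refl := fun _ => ⟨fun _ _ => Iff.rfl, rfl⟩
      symm := fun h => ⟨fun t ht => (h.1 t ht).symm, h.2.symm⟩
      trans := fun h h' => ⟨fun t ht => (h.1 t ht).trans (h'.1 t ht), h.2.trans h'.2⟩ }

end DNFEval

theorem mainTheorem4 (n : ℕ) (φ : DNFEval.MonotoneDNF n) (p c : Fin n → ℝ)
    (hp : ∀ i, 0 < p i ∧ p i < 1) (hc : ∀ i, 0 ≤ c i) :
    ∃ S : DNFEval.DecisionTree n,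
      DNFEval.IsOptimalStrategy p c φ.eval S ∧
      (∀ x y : Fin n, φ.Siblings x y → DNFEval.ratio p c x < DNFEval.ratio p c y →
        S.NotBefore x y) ∧
      (∀ x : Fin n, S.Contiguous (DNFEval.rClass φ p c x)) := by
  obtain ⟨T, hT⟩ := DNFEval.exists_minimal hp hc Finset.univ φ.eval
    (fun x y h => congrArg φ.eval (funext fun i => h i (by simp)))
  obtain ⟨S, hS, -, hcont⟩ := hT.exists_contiguous hp hc (DNFEval.rSetoid φ p c)
    (fun _ _ h => DNFEval.mul_eq_mul_of_ratio_eq hp hc h.2) (fun _ _ _ _ _ h => h.1.twins)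
  exact ⟨S, DNFEval.isOptimalStrategy_iff.2 hS,
    fun _ _ hxy hlt _ _ hπ => hS.mem_of_ratio_lt hp hc
      (DNFEval.mul_lt_mul_of_ratio_lt hp hc hlt) (Finset.mem_univ _) (fun _ => hxy.twins) hπ,
    hcont⟩
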